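/- Let $d\ge 3$. A bounded closed set $K\subset\mathbb R^d$ is called porous if there is a constant $0<c<1$ such that each ball $B\subset\mathbb R^d$ contains a ball $B'\subset B$ with $B'\cap K=\varnothing$ and $|B'|\ge c|B|$, where $|\cdot|$ is Lebesgue measure. A modulus of continuity is a continuous, increasing (not necessarily strictly), concave function $\omega:[0,\infty)\to[0,\infty)$ with $\omega(0)=0$ and $\omega(t)>0$ for $t>0$; for $f:\mathbb R^d\to\mathbb R$ put $$\|f\|_\omega=\sup_{x,y\in\mathbb R^d,\;x\ne y}\frac{|f(x)-f(y)|}{\omega(|x-y|)} .$$ For $\delta>0$ let $K_\delta=\{x\in\mathbb R^d:\inf_{y\in K}|x-y|<\delta\}$. A cube is a half-open set $[a_1,a_1+\ell)\times\dots\times[a_d,a_d+\ell)$ with $\ell>0$. Let $K\subset\mathbb R^d$ be a porous compact set. There is a constant $C>0$, depending only on $d$ and $K$, such that the following holds. Let $R_0$ be a cube with $K\subset R_0$ and $\operatorname{dist}(K,\partial R_0)\ge 1/4$, let $\omega$ be a modulus of continuity, and let $f\in C^\infty(\mathbb R^d)$ be real-valued with $\operatorname{supp} f\subset R_0$. Then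 $\|f\|_\omega<\infty$, and for each $0<\delta<1/4$ there is a function $G_\delta$, harmonic in $K_\delta$, such that $$\sup_{K_\delta}|f-G_\delta|\le C\,\|f\|_\omega\,\omega(\delta).$$ In particular, $C$ does not depend on $\delta$, $f$ or $\|f\|_\omega$. -/

import Mathlib

open Set MeasureTheory
open scoped ENNReal

namespace HarmonicApprox

/-- The half-open cube `[a₁, a₁ + l) × ⋯ × [a_d, a_d + l)` with sides parallel to the axes. -/
def cube {d : ℕ} (a : EuclideanSpace ℝ (Fin d)) (l : ℝ) : Set (EuclideanSpace ℝ (Fin d)) :=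
  {x | ∀ i, a i ≤ x i ∧ x i < a i + l}

/-- The Euclidean distance `inf {|x - y| : x ∈ A, y ∈ B}` between two sets
(equal to `∞` if one of them is empty). -/
noncomputable def setDist {d : ℕ} (A B : Set (EuclideanSpace ℝ (Fin d))) : ℝ≥0∞ :=
  ⨅ x ∈ A, ⨅ y ∈ B, edist x y

/-- A porous set: bounded, closed, and there is `0 < c < 1` such that each ball `B` contains a ball
`B'` which does not meet `K` and has Lebesgue measure at least `c |B|`. -/
def IsPorous {d : ℕ} (K : Set (EuclideanSpace ℝ (Fin d))) : Prop :=
  Bornology.IsBounded K ∧ IsClosed K ∧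
    ∃ c : ℝ, 0 < c ∧ c < 1 ∧
      ∀ (x : EuclideanSpace ℝ (Fin d)) (r : ℝ), 0 < r →
        ∃ (y : EuclideanSpace ℝ (Fin d)) (s : ℝ), 0 < s ∧
          Metric.ball y s ⊆ Metric.ball x r ∧ Metric.ball y s ∩ K = ∅ ∧
          ENNReal.ofReal c * volume (Metric.ball x r) ≤ volume (Metric.ball y s)

/-- A modulus of continuity: a continuous, increasing, concave function on `[0, ∞)` with
`ω 0 = 0`. Increasing is meant in the weak sense, so that `t ↦ min t 1` is allowed; only the zero
function is then excluded by positivity on `(0, ∞)`, which strict monotonicity would imply.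
Values of `ω` at negative arguments are irrelevant. -/
structure IsModulus (ω : ℝ → ℝ) : Prop where
  continuousOn : ContinuousOn ω (Ici 0)
  monotoneOn : MonotoneOn ω (Ici 0)
  concaveOn : ConcaveOn ℝ (Ici 0) ω
  map_zero : ω 0 = 0
  pos : ∀ t, 0 < t → 0 < ω t

/-- The seminorm `‖f‖_ω = sup {|f x - f y| / ω |x - y| : x, y ∈ S, x ≠ y}` of `Lip_ω(S)`, as an
extended nonnegative real. -/
noncomputable def lipSeminorm {d : ℕ} (ω : ℝ → ℝ) (S : Set (EuclideanSpace ℝ (Fin d)))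
    (f : EuclideanSpace ℝ (Fin d) → ℝ) : ℝ≥0∞ :=
  ⨆ x ∈ S, ⨆ y ∈ S, ⨆ _ : x ≠ y, ENNReal.ofReal (|f x - f y| / ω (dist x y))

end HarmonicApprox

namespace HarmonicApprox

open Filter Topology Module Laplacian
open scoped Convolution

/-! Put `s = (d - 2) / 2` and `A = ‖f‖_ω ω(δ)`. Dilating by `δ` reduces the claim to scale one: by
concavity of `ω`, `F = f(δ ·)` satisfies `|F x - F y| ≤ A max(1, |x - y|)`, and porosity puts,
within a fixed distance `M` of any point, a point at distance at least 4 from the dilated `K`. It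
remains to approximate `F` within `C A` on the 1-neighbourhood of that set by finite sums of
Newtonian kernels with poles farther away than 1.

A fixed multiple of `F` is, up to `O(A)`, a potential with bounded density
(`exists_potential_approximation`). The density is `h = F * Δχ` for a unit-scale mollifier `χ`; it
is `O(A)` because `Δχ` has mean zero. The kernel is the smooth `regPot`, whose Laplacian `ρ` is
integrable against `2 + |x|` and has nonzero integral; moving `Δ` across gives `h * regPot = (F * χ)
* ρ`, which is close to `(∫ ρ) F`.

The kernel `regPot (x - y)` is then replaced by a combination of Newtonian kernels with poles near a
point `Z y` far from `K` (`exists_abs_regPot_sub_interpolation_le`). The replacement agrees with it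
through second order at infinity. The Newtonian kernel decays like `|x|^(2 - d)` and each matched
order gains one power, so the error is `O((1 + |x - y|)^(-(d + 1)))`. This is integrable in `y`, and
the total error is `O(A)` with no dependence on the size of the support of `F`. Taking `Z` with
finitely many values turns the integral into a finite sum (`exists_poleSpan_approximation`). -/

/-- The potential `(|x|² + t)^(-s)`: the Newtonian kernel in dimension `2 s + 2` if `t = 0`, and a
smooth regularization of it if `t > 0`. -/
noncomputable def pot {d : ℕ} (s t : ℝ) (x : EuclideanSpace ℝ (Fin d)) : ℝ :=
  (‖x‖ ^ 2 + t) ^ (-s)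

/-! ### Derivatives and Laplacian of the regularized Newtonian kernels. -/

section Potential

variable {d : ℕ} {s t : ℝ} {x : EuclideanSpace ℝ (Fin d)}

theorem hasFDerivAt_norm_sq_add_rpow (r : ℝ) (hx : ‖x‖ ^ 2 + t ≠ 0) :
    HasFDerivAt (fun y : EuclideanSpace ℝ (Fin d) => (‖y‖ ^ 2 + t) ^ r)
      ((2 * r * (‖x‖ ^ 2 + t) ^ (r - 1)) • innerSL ℝ x) x := by
  have h1 : HasFDerivAt (fun y : EuclideanSpace ℝ (Fin d) => ‖y‖ ^ 2 + t)
      (2 • innerSL ℝ x) x := ((hasStrictFDerivAt_norm_sq x).hasFDerivAt).add_const t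
  have h2 := h1.rpow_const (p := r) (Or.inl hx)
  refine h2.congr_fderiv ?_
  rw [← Nat.cast_smul_eq_nsmul ℝ, smul_smul]
  congr 1
  push_cast
  ring

theorem contDiffAt_pot {n : WithTop ℕ∞} (hx : ‖x‖ ^ 2 + t ≠ 0) : ContDiffAt ℝ n (pot s t) x :=
  ContDiffAt.rpow_const_of_ne ((contDiff_norm_sq ℝ).contDiffAt.add contDiffAt_const) hx

theorem contDiff_pot {n : WithTop ℕ∞} (ht : 0 < t) :
    ContDiff ℝ n (pot s t : EuclideanSpace ℝ (Fin d) → ℝ) :=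
  contDiff_iff_contDiffAt.2 fun _ => contDiffAt_pot (by positivity)

theorem fderiv_fderiv_pot (hx : ‖x‖ ^ 2 + t ≠ 0) (v : EuclideanSpace ℝ (Fin d)) :
    fderiv ℝ (fderiv ℝ (pot s t)) x v v =
      4 * s * (s + 1) * (‖x‖ ^ 2 + t) ^ (-s - 2) * (inner ℝ x v) ^ 2
        - 2 * s * (‖x‖ ^ 2 + t) ^ (-s - 1) * ‖v‖ ^ 2 := by
  have hc : Continuous fun y : EuclideanSpace ℝ (Fin d) => ‖y‖ ^ 2 + t := by fun_prop
  have h1 : fderiv ℝ (pot s t) =ᶠ[𝓝 x]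
      fun y => (2 * -s * (‖y‖ ^ 2 + t) ^ (-s - 1)) • innerSL ℝ y := by
    filter_upwards [hc.continuousAt.eventually_ne hx] with y hy
    exact (hasFDerivAt_norm_sq_add_rpow (-s) hy).fderiv
  have h2 := (((hasFDerivAt_norm_sq_add_rpow (-s - 1) hx).const_mul (2 * -s)).smul
    (innerSL ℝ : EuclideanSpace ℝ (Fin d) →L[ℝ] _).hasFDerivAt)
  rw [h1.fderiv_eq]
  erw [h2.fderiv]
  have e : -s - 1 - 1 = -s - 2 := by ring
  have a (u w : EuclideanSpace ℝ (Fin d)) : innerSL ℝ u w = inner ℝ u w := rfl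
  simp only [e, add_apply, smul_apply,
    ContinuousLinearMap.smulRight_apply, smul_eq_mul]
  erw [a, a]
  rw [real_inner_self_eq_norm_sq]
  ring

/-- The trace of the Hessian is `4 s (s + 1) |x|² (|x|² + t)^(-s - 2) - 2 s d (|x|² + t)^(-s - 1)`.
Since `d = 2 s + 2`, the `|x|²` terms cancel and only the contribution of `t` survives. -/
theorem laplacian_pot (hs : (d : ℝ) = 2 * s + 2) (hx : ‖x‖ ^ 2 + t ≠ 0) (hp : 0 ≤ t) :
    Δ (pot s t) x = -(4 * s * (s + 1) * t * (‖x‖ ^ 2 + t) ^ (-s - 2)) := by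
  rw [InnerProductSpace.laplacian_eq_iteratedFDeriv_orthonormalBasis _
    (EuclideanSpace.basisFun (Fin d) ℝ)]
  have h0 : 0 < ‖x‖ ^ 2 + t := lt_of_le_of_ne (by positivity) hx.symm
  have h1 : (‖x‖ ^ 2 + t) ^ (-s - 1) = (‖x‖ ^ 2 + t) ^ (-s - 2) * (‖x‖ ^ 2 + t) := by
    rw [← Real.rpow_add_one hx]
    congr 1
    ring
  have h2 : ∑ i, (x i) ^ 2 = ‖x‖ ^ 2 := (EuclideanSpace.real_norm_sq_eq x).symm
  simp only [iteratedFDeriv_two_apply, Matrix.cons_val_zero, Matrix.cons_val_one,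
    fderiv_fderiv_pot hx]
  simp [Finset.sum_sub_distrib, ← Finset.mul_sum, h2, h1, hs, EuclideanSpace.inner_single_right]
  ring

theorem harmonicAt_pot (hs : (d : ℝ) = 2 * s + 2) (hx : x ≠ 0) :
    InnerProductSpace.HarmonicAt (pot s 0) x := by
  refine ⟨contDiffAt_pot (by simpa using hx), ?_⟩
  filter_upwards [isOpen_ne.mem_nhds hx] with y hy
  rw [laplacian_pot hs (by simpa using hy) le_rfl]
  simp

end Potential

/-! ### One-variable Taylor and second-difference bounds. -/

section Taylor

/-- The mean value inequality is applied three times, from `g''` down to `g`. The factor 1/6 of the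
sharp remainder is dropped, as constants do not matter. -/
theorem abs_sub_taylor_two_le {g g' g'' g''' : ℝ → ℝ} {B : ℝ}
    (h : ∀ τ ∈ Icc (0 : ℝ) 1, HasDerivAt g (g' τ) τ)
    (h' : ∀ τ ∈ Icc (0 : ℝ) 1, HasDerivAt g' (g'' τ) τ)
    (h'' : ∀ τ ∈ Icc (0 : ℝ) 1, HasDerivAt g'' (g''' τ) τ)
    (hB : ∀ τ ∈ Icc (0 : ℝ) 1, |g''' τ| ≤ B) :
    |g 1 - (g 0 + g' 0 + g'' 0 / 2)| ≤ B := by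
  have h0 : (0 : ℝ) ∈ Icc (0 : ℝ) 1 := by simp
  have hB0 : 0 ≤ B := (abs_nonneg _).trans (hB 0 h0)
  have key : ∀ k k' : ℝ → ℝ, (∀ τ ∈ Icc (0 : ℝ) 1, HasDerivAt k (k' τ) τ) →
      (∀ τ ∈ Icc (0 : ℝ) 1, |k' τ| ≤ B) → ∀ τ ∈ Icc (0 : ℝ) 1, |k τ - k 0| ≤ B := by
    intro k k' hk hk' τ hτ
    have := (convex_Icc (0 : ℝ) 1).norm_image_sub_le_of_norm_hasDerivWithin_le
      (fun x hx => (hk x hx).hasDerivWithinAt) hk' h0 hτ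
    refine this.trans (mul_le_of_le_one_right hB0 ?_)
    simpa [abs_of_nonneg hτ.1] using hτ.2
  have k2 := key _ _ h'' hB
  have k1 := key (fun τ => g' τ - τ * g'' 0) (fun τ => g'' τ - g'' 0)
    (fun τ hτ => ((h' τ hτ).sub ((hasDerivAt_id τ).mul_const (g'' 0))).congr_deriv (by simp)) k2
  have k0 := key (fun τ => g τ - (τ * g' 0 + τ ^ 2 * (g'' 0 / 2)))
    (fun τ => g' τ - τ * g'' 0 - (g' 0 - 0 * g'' 0))
    (fun τ hτ => ((h τ hτ).sub (((hasDerivAt_id τ).mul_const (g' 0)).add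
      ((hasDerivAt_pow 2 τ).mul_const (g'' 0 / 2)))).congr_deriv (by simp; ring)) k1
  convert k0 1 (by simp) using 2
  ring

theorem abs_second_difference_le {u u' u'' : ℝ → ℝ} {B : ℝ}
    (h : ∀ τ ∈ Icc (0 : ℝ) 2, HasDerivAt u (u' τ) τ)
    (h' : ∀ τ ∈ Icc (0 : ℝ) 2, HasDerivAt u' (u'' τ) τ)
    (hB : ∀ τ ∈ Icc (0 : ℝ) 2, |u'' τ| ≤ B) :
    |2 * u 1 - u 2 - u 0| ≤ B := by
  have k1 : ∀ τ ∈ Icc (0 : ℝ) 1, |u' (τ + 1) - u' τ| ≤ B := by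
    intro τ hτ
    have := (convex_Icc (0 : ℝ) 2).norm_image_sub_le_of_norm_hasDerivWithin_le
      (fun x hx => (h' x hx).hasDerivWithinAt) hB
      (x := τ) (y := τ + 1) ⟨hτ.1, by linarith [hτ.2]⟩ ⟨by linarith [hτ.1], by linarith [hτ.2]⟩
    simpa using this
  have k0 := (convex_Icc (0 : ℝ) 1).norm_image_sub_le_of_norm_hasDerivWithin_le
    (f := fun τ => u (τ + 1) - u τ)
    (fun x hx => (((h (x + 1) ⟨by linarith [hx.1], by linarith [hx.2]⟩).comp_add_const x 1).sub
      (h x ⟨hx.1, by linarith [hx.2]⟩)).hasDerivWithinAt) k1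
      (x := 0) (y := 1) (by simp) (by simp)
  rw [← abs_neg]
  convert k0 using 1
  · rw [Real.norm_eq_abs]
    norm_num
    ring_nf
  · simp

end Taylor

/-! ### Expansion of the kernels at infinity and a quadratic interpolation rule. -/

section Estimates

variable {d : ℕ} {s : ℝ}

theorem sq_rpow_neg {r : ℝ} (hr : 0 < r) (a : ℝ) : (r ^ 2) ^ a = r ^ (2 * a) := by
  rw [← Real.rpow_natCast, ← Real.rpow_mul hr.le]
  norm_num

/-- Second order Taylor expansion of the Newtonian kernel. -/
theorem exists_abs_pot_sub_taylor_le (hs : 0 ≤ s) :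
    ∃ C : ℝ, 0 ≤ C ∧ ∀ p : EuclideanSpace ℝ (Fin d), p ≠ 0 → ∃ α β γ ε : ℝ,
      ∀ w : EuclideanSpace ℝ (Fin d), 2 * ‖w‖ ≤ ‖p‖ →
        |pot s 0 (p + w) - (α + β * inner ℝ p w + γ * inner ℝ p w ^ 2 + ε * ‖w‖ ^ 2)| ≤
          C * ‖w‖ ^ 3 * ‖p‖ ^ (-(2 * s + 3)) := by
  refine ⟨(8 * s * (s + 1) * (s + 2) + 12 * s * (s + 1)) * (1 / 2) ^ (-(2 * s + 3)),
    by positivity, fun p hp => ⟨(‖p‖ ^ 2) ^ (-s), -2 * s * (‖p‖ ^ 2) ^ (-s - 1),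
    2 * s * (s + 1) * (‖p‖ ^ 2) ^ (-s - 2), -s * (‖p‖ ^ 2) ^ (-s - 1), fun w hw => ?_⟩⟩
  have hp0 : 0 < ‖p‖ := norm_pos_iff.2 hp
  -- The expansion is taken along the segment from `p` to `p + w`: `q` is the squared norm there and
  -- `2 a` is its derivative, so every derivative of `q ^ (-s)` is a polynomial in `a` and `‖w‖ ^ 2`
  -- times powers of `q`.
  set a : ℝ → ℝ := fun τ => inner ℝ p w + τ * ‖w‖ ^ 2 with ha
  set q : ℝ → ℝ := fun τ => ‖p + τ • w‖ ^ 2 with hq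
  have hq_eq : ∀ τ, q τ = ‖p‖ ^ 2 + 2 * τ * inner ℝ p w + τ ^ 2 * ‖w‖ ^ 2 := by
    intro τ
    simp only [hq]
    rw [norm_add_sq_real, inner_smul_right, norm_smul, mul_pow, Real.norm_eq_abs, sq_abs]
    ring
  have hr : ∀ τ ∈ Icc (0 : ℝ) 1, 1 / 2 * ‖p‖ ≤ ‖p + τ • w‖ := by
    intro τ hτ
    have h1 : ‖p‖ - ‖τ • w‖ ≤ ‖p + τ • w‖ := norm_sub_le_norm_add _ _
    have h2 : ‖τ • w‖ ≤ ‖w‖ := by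
      rw [norm_smul, Real.norm_eq_abs, abs_of_nonneg hτ.1]
      exact mul_le_of_le_one_left (norm_nonneg _) hτ.2
    linarith
  have hq0 : ∀ τ ∈ Icc (0 : ℝ) 1, q τ ≠ 0 := fun τ hτ => by
    have := hr τ hτ
    have : 0 < ‖p + τ • w‖ := by linarith
    positivity
  have da : ∀ τ, HasDerivAt a (‖w‖ ^ 2) τ := fun τ =>
    (((hasDerivAt_id τ).mul_const (‖w‖ ^ 2)).const_add (inner ℝ p w)).congr_deriv (by simp)
  have dq : ∀ τ, HasDerivAt q (2 * a τ) τ := fun τ => by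
    rw [show q = fun τ => ‖p‖ ^ 2 + 2 * τ * inner ℝ p w + τ ^ 2 * ‖w‖ ^ 2 from funext hq_eq]
    exact (((((hasDerivAt_id τ).const_mul 2).mul_const (inner ℝ p w)).const_add (‖p‖ ^ 2)).add
      ((hasDerivAt_pow 2 τ).mul_const (‖w‖ ^ 2))).congr_deriv (by simp [ha]; ring)
  have dr : ∀ (b : ℝ), ∀ τ ∈ Icc (0 : ℝ) 1,
      HasDerivAt (fun τ => q τ ^ b) (2 * b * a τ * q τ ^ (b - 1)) τ := fun b τ hτ => by
    convert (dq τ).rpow_const (p := b) (Or.inl (hq0 τ hτ)) using 1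
    ring
  have e2 : -s - 1 - 1 = -s - 2 := by ring
  have e3 : -s - 2 - 1 = -s - 3 := by ring
  have key := abs_sub_taylor_two_le
    (g := fun τ => q τ ^ (-s)) (g' := fun τ => 2 * -s * a τ * q τ ^ (-s - 1))
    (g'' := fun τ => -2 * s * ‖w‖ ^ 2 * q τ ^ (-s - 1) +
      4 * s * (s + 1) * a τ ^ 2 * q τ ^ (-s - 2))
    (g''' := fun τ => 12 * s * (s + 1) * a τ * ‖w‖ ^ 2 * q τ ^ (-s - 2)
      - 8 * s * (s + 1) * (s + 2) * a τ ^ 3 * q τ ^ (-s - 3))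
    (B := (8 * s * (s + 1) * (s + 2) + 12 * s * (s + 1)) * (1 / 2) ^ (-(2 * s + 3)) * ‖w‖ ^ 3 *
      ‖p‖ ^ (-(2 * s + 3)))
    (dr (-s)) ?_ ?_ ?_
  · have hq1 : q 1 = ‖p + w‖ ^ 2 := by simp [hq]
    have hq0 : q 0 = ‖p‖ ^ 2 := by simp [hq]
    have ha0 : a 0 = inner ℝ p w := by simp [ha]
    simp only [hq1, hq0, ha0] at key
    convert key using 2
    simp only [pot, add_zero]
    ring
  · intro τ hτ
    refine (((da τ).const_mul (2 * -s)).mul (dr (-s - 1) τ hτ)).congr_deriv ?_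
    rw [e2]
    ring
  · intro τ hτ
    refine (((dr (-s - 1) τ hτ).const_mul (-2 * s * ‖w‖ ^ 2)).add
      ((((da τ).pow 2).const_mul (4 * s * (s + 1))).mul (dr (-s - 2) τ hτ))).congr_deriv ?_
    rw [e2, e3]
    simp
    ring
  · intro τ hτ
    set r := ‖p + τ • w‖ with hrdef
    have hr0 : 0 < r := by linarith [hr τ hτ]
    have hqr : q τ = r ^ 2 := rfl
    have har : |a τ| ≤ r * ‖w‖ := by
      have : a τ = inner ℝ (p + τ • w) w := by
        rw [inner_add_left, real_inner_smul_left, real_inner_self_eq_norm_sq]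
      rw [this]
      exact abs_real_inner_le_norm _ _
    have p2 : q τ ^ (-s - 2) * r = r ^ (-(2 * s + 3)) := by
      rw [hqr, sq_rpow_neg hr0, ← Real.rpow_add_one hr0.ne']
      congr 1
      ring
    have p3 : q τ ^ (-s - 3) * r ^ 3 = r ^ (-(2 * s + 3)) := by
      rw [hqr, sq_rpow_neg hr0, ← Real.rpow_natCast, ← Real.rpow_add hr0]
      congr 1
      push_cast
      ring
    have hn2 : 0 ≤ q τ ^ (-s - 2) := by rw [hqr]; positivity
    have hn3 : 0 ≤ q τ ^ (-s - 3) := by rw [hqr]; positivity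
    have hfin : r ^ (-(2 * s + 3)) ≤ (1 / 2) ^ (-(2 * s + 3)) * ‖p‖ ^ (-(2 * s + 3)) := by
      rw [← Real.mul_rpow (by norm_num) hp0.le]
      exact Real.rpow_le_rpow_of_nonpos (by positivity) (hr τ hτ) (by linarith)
    calc _ ≤ |12 * s * (s + 1) * a τ * ‖w‖ ^ 2 * q τ ^ (-s - 2)|
          + |8 * s * (s + 1) * (s + 2) * a τ ^ 3 * q τ ^ (-s - 3)| := abs_sub _ _
      _ = 12 * s * (s + 1) * |a τ| * ‖w‖ ^ 2 * q τ ^ (-s - 2)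
          + 8 * s * (s + 1) * (s + 2) * |a τ| ^ 3 * q τ ^ (-s - 3) := by
        simp only [abs_mul, abs_pow, abs_norm, abs_of_nonneg hn2, abs_of_nonneg hn3]
        rw [abs_of_nonneg hs, abs_of_nonneg (by linarith : 0 ≤ s + 1),
          abs_of_nonneg (by linarith : 0 ≤ s + 2)]
        norm_num
      _ ≤ 12 * s * (s + 1) * (r * ‖w‖) * ‖w‖ ^ 2 * q τ ^ (-s - 2)
          + 8 * s * (s + 1) * (s + 2) * (r * ‖w‖) ^ 3 * q τ ^ (-s - 3) := by
        gcongr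
      _ = 12 * s * (s + 1) * ‖w‖ ^ 3 * (q τ ^ (-s - 2) * r)
          + 8 * s * (s + 1) * (s + 2) * ‖w‖ ^ 3 * (q τ ^ (-s - 3) * r ^ 3) := by ring
      _ = (8 * s * (s + 1) * (s + 2) + 12 * s * (s + 1)) * ‖w‖ ^ 3 * r ^ (-(2 * s + 3)) := by
        rw [p2, p3]
        ring
      _ ≤ (8 * s * (s + 1) * (s + 2) + 12 * s * (s + 1)) * ‖w‖ ^ 3 *
          ((1 / 2) ^ (-(2 * s + 3)) * ‖p‖ ^ (-(2 * s + 3))) := by gcongr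
      _ = _ := by ring

/-- The regularized kernel `2 pot s 1 - pot s 2` is a high order approximation of `pot s 0` at
infinity. -/
theorem abs_pot_regularized_sub_le (hs : 0 ≤ s) {p : EuclideanSpace ℝ (Fin d)} (hp : 1 ≤ ‖p‖) :
    |2 * pot s 1 p - pot s 2 p - pot s 0 p| ≤ s * (s + 1) * ‖p‖ ^ (-(2 * s + 3)) := by
  have hp0 : 0 < ‖p‖ := by linarith
  have dr : ∀ (b : ℝ), ∀ τ ∈ Icc (0 : ℝ) 2,
      HasDerivAt (fun τ => (‖p‖ ^ 2 + τ) ^ b) (b * (‖p‖ ^ 2 + τ) ^ (b - 1)) τ := fun b τ hτ => by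
    have := hτ.1
    simpa using ((hasDerivAt_id τ).const_add (‖p‖ ^ 2)).rpow_const (p := b)
      (Or.inl (by simp only [id]; positivity))
  -- The left side is a second difference of `τ ↦ pot s τ p` at 0, 1, 2, which removes the term
  -- linear in `τ`. The remaining decay is of order `2 s + 4`, more than is needed.
  refine (abs_second_difference_le (u := fun τ => (‖p‖ ^ 2 + τ) ^ (-s))
    (u' := fun τ => -s * (‖p‖ ^ 2 + τ) ^ (-s - 1))
    (u'' := fun τ => -s * ((-s - 1) * (‖p‖ ^ 2 + τ) ^ (-s - 1 - 1)))
    (dr (-s)) (fun τ hτ => (dr (-s - 1) τ hτ).const_mul (-s)) ?_)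
  intro τ hτ
  have h0 := hτ.1
  rw [show -s * ((-s - 1) * (‖p‖ ^ 2 + τ) ^ (-s - 1 - 1)) =
    s * (s + 1) * (‖p‖ ^ 2 + τ) ^ (-s - 2) by ring_nf, abs_of_nonneg (by positivity)]
  gcongr
  calc (‖p‖ ^ 2 + τ) ^ (-s - 2) ≤ (‖p‖ ^ 2) ^ (-s - 2) :=
        Real.rpow_le_rpow_of_nonpos (by positivity) (by linarith) (by linarith)
    _ = ‖p‖ ^ (2 * (-s - 2)) := sq_rpow_neg hp0 _
    _ ≤ ‖p‖ ^ (-(2 * s + 3)) := Real.rpow_le_rpow_of_exponent_le hp (by linarith)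

/-- A quadrature rule, with nodes in the ball of radius `2` and continuous weights, which reproduces
the quadratic parts of potentials. -/
theorem exists_interpolation (d : ℕ) :
    ∃ (ι : Type) (_ : Fintype ι) (w : ι → EuclideanSpace ℝ (Fin d))
      (c : ι → EuclideanSpace ℝ (Fin d) → ℝ), (∀ i, ‖w i‖ ≤ 2) ∧ (∀ i, Continuous (c i)) ∧
      ∀ (α β γ ε : ℝ) (p v : EuclideanSpace ℝ (Fin d)),
        ∑ i, c i v * (α + β * inner ℝ p (w i) + γ * inner ℝ p (w i) ^ 2 + ε * ‖w i‖ ^ 2) =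
          α + β * inner ℝ p v + γ * inner ℝ p v ^ 2 + ε * ‖v‖ ^ 2 := by
  set e : Fin d → EuclideanSpace ℝ (Fin d) := fun i => EuclideanSpace.single i 1
  -- For quadratic `Q` one has `Q v = Q 0 + ∑ i, v i (Q (e i) - Q (-e i)) / 2 + ½ ∑ i j, v i v j (Q
  -- (e i + e j) - Q (e i) - Q (e j) + Q 0)`. The weights collect the coefficients of each value of
  -- `Q`.
  refine ⟨Unit ⊕ Fin d ⊕ Fin d ⊕ (Fin d × Fin d), inferInstance,
    Sum.elim (fun _ => 0) (Sum.elim e (Sum.elim (-e) fun ij => e ij.1 + e ij.2)),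
    Sum.elim (fun _ v => 1 + (∑ i, v i) ^ 2 / 2) (Sum.elim (fun i v => v i / 2 - v i * ∑ j, v j)
      (Sum.elim (fun i v => - v i / 2) fun ij v => v ij.1 * v ij.2 / 2)), ?_, ?_, ?_⟩
  · have he : ∀ i, ‖e i‖ = 1 := fun i => by simp [e]
    rintro (_ | i | i | ⟨i, j⟩)
    · simp
    · simp [he]
    · simp [he]
    · exact (norm_add_le _ _).trans (by simp [he]; norm_num)
  · rintro (_ | i | i | ⟨i, j⟩) <;> simp <;> fun_prop
  · intro α β γ ε p v
    have he : ∀ i, inner ℝ p (e i) = p i := fun i => by simp [e, EuclideanSpace.inner_single_right]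
    have hn : ∀ i, ‖e i‖ ^ 2 = 1 := fun i => by simp [e]
    have hij : ∀ i j, ‖e i + e j‖ ^ 2 = 2 + if i = j then 2 else 0 := by
      intro i j
      rw [norm_add_sq_real, hn, hn]
      simp only [e, EuclideanSpace.inner_single_left]
      simp
      split_ifs <;> norm_num
    have hpv : inner ℝ p v = ∑ i, v i * p i := by simp [PiLp.inner_apply]
    have hv : ‖v‖ ^ 2 = ∑ i, v i ^ 2 := EuclideanSpace.real_norm_sq_eq v
    have hd (i : Fin d) : ∑ j, v j * (if i = j then (1 : ℝ) else 0) = v i := by simp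
    have h2 (i j : Fin d) : v i * v j / 2 * (α + β * (p i + p j) + γ * (p i + p j) ^ 2 +
        ε * (2 + if i = j then 2 else 0)) =
      v i * (α / 2 + β / 2 * p i + γ / 2 * p i ^ 2 + ε) * v j + β / 2 * v i * (v j * p j) +
      γ * (v i * p i) * (v j * p j) + γ / 2 * v i * (v j * p j ^ 2) +
      ε * v i * (v j * (if i = j then (1 : ℝ) else 0)) := by
      split_ifs <;> ring
    rw [hpv, hv]
    simp only [Fintype.sum_sum_type, Fintype.sum_prod_type, Sum.elim_inl, Sum.elim_inr,
      Pi.neg_apply, inner_add_right, inner_neg_right, norm_neg, he, hn, hij, h2,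
      Finset.sum_add_distrib, ← Finset.mul_sum, hd]
    generalize hS : ∑ i, v i = S
    have h1 (i : Fin d) : (v i / 2 - v i * S) * (α + β * p i + γ * p i ^ 2 + ε * 1) =
        (1 / 2 - S) * (α + ε) * v i + (1 / 2 - S) * β * (v i * p i) +
          (1 / 2 - S) * γ * (v i * p i ^ 2) := by ring
    have h1' (i : Fin d) : -v i / 2 * (α + β * -p i + γ * (-p i) ^ 2 + ε * 1) =
        -(1 / 2) * (α + ε) * v i + 1 / 2 * β * (v i * p i) + -(1 / 2) * γ * (v i * p i ^ 2) := by
      ring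
    have h3 (i : Fin d) : v i * (α / 2 + β / 2 * p i + γ / 2 * p i ^ 2 + ε) =
        (α / 2 + ε) * v i + β / 2 * (v i * p i) + γ / 2 * (v i * p i ^ 2) := by ring
    have h4 (i : Fin d) (T : ℝ) : β / 2 * v i * T = β / 2 * T * v i := by ring
    have h5 (i : Fin d) (T : ℝ) : γ * (v i * p i) * T = γ * T * (v i * p i) := by ring
    have h6 (i : Fin d) (T : ℝ) : γ / 2 * v i * T = γ / 2 * T * v i := by ring
    have h7 (i : Fin d) : ε * v i * v i = ε * v i ^ 2 := by ring
    simp only [h1, h1', h3, h4, h5, h6, h7, Finset.sum_add_distrib, ← Finset.mul_sum,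
      ← Finset.sum_mul, hS]
    simp
    ring

end Estimates

/-! ### The smooth kernel `regPot`, its interpolation by Newtonian kernels, and its Laplacian. -/

section Kernel

variable {d : ℕ} {s : ℝ}

/-- A smooth function which agrees to high order with the Newtonian kernel `pot s 0` at infinity. -/
noncomputable def regPot {d : ℕ} (s : ℝ) (x : EuclideanSpace ℝ (Fin d)) : ℝ :=
  2 * pot s 1 x - pot s 2 x

theorem pot_nonneg {t : ℝ} (ht : 0 ≤ t) (x : EuclideanSpace ℝ (Fin d)) : 0 ≤ pot s t x :=
  Real.rpow_nonneg (by positivity) _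

theorem pot_le_one {t : ℝ} (hs : 0 ≤ s) {x : EuclideanSpace ℝ (Fin d)} (hx : 1 ≤ ‖x‖ ^ 2 + t) :
    pot s t x ≤ 1 :=
  Real.rpow_le_one_of_one_le_of_nonpos hx (by linarith)

/-- Far out, both sides are compared with the second-order Taylor polynomial of `pot s 0` at `p`,
which the quadrature rule reproduces exactly. The exponent `2 s + 3` is `d + 1` when `d = 2 s + 2`,
hence integrable. -/
theorem exists_abs_regPot_sub_interpolation_le (hs : 0 ≤ s) {M : ℝ} (hM : 2 ≤ M) {ι : Type}
    [Fintype ι] {w : ι → EuclideanSpace ℝ (Fin d)} {c : ι → EuclideanSpace ℝ (Fin d) → ℝ}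
    (hw : ∀ i, ‖w i‖ ≤ 2) (hc : ∀ i, Continuous (c i))
    (hwc : ∀ (α β γ ε : ℝ) (p v : EuclideanSpace ℝ (Fin d)),
      ∑ i, c i v * (α + β * inner ℝ p (w i) + γ * inner ℝ p (w i) ^ 2 + ε * ‖w i‖ ^ 2) =
        α + β * inner ℝ p v + γ * inner ℝ p v ^ 2 + ε * ‖v‖ ^ 2) :
    ∃ C : ℝ, 0 ≤ C ∧ ∀ p v : EuclideanSpace ℝ (Fin d), 3 ≤ ‖p‖ → ‖v‖ ≤ M →
      |regPot s (p + v) - ∑ i, c i v * pot s 0 (p + w i)| ≤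
        C * (1 + ‖p + v‖) ^ (-(2 * s + 3)) := by
  obtain ⟨C₀, hC₀, hT⟩ := exists_abs_pot_sub_taylor_le (d := d) hs
  obtain ⟨B, hB⟩ :=
    (isCompact_closedBall (0 : EuclideanSpace ℝ (Fin d)) M).exists_bound_of_continuousOn (f := fun v => ∑ i, |c i v|) (by fun_prop)
  have hB' : ∀ v : EuclideanSpace ℝ (Fin d), ‖v‖ ≤ M → ∑ i, |c i v| ≤ B := fun v hv =>
    (le_abs_self _).trans (hB v (by simpa using hv))
  have hB0 : 0 ≤ B := (Finset.sum_nonneg fun i _ => abs_nonneg _).trans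
    (hB' 0 (by simp; linarith))
  have hsum : ∀ (v : EuclideanSpace ℝ (Fin d)) (J : ι → ℝ) (b : ℝ), ‖v‖ ≤ M → 0 ≤ b →
      (∀ i, |J i| ≤ b) → |∑ i, c i v * J i| ≤ B * b := by
    intro v J b hv hb hJ
    calc |∑ i, c i v * J i| ≤ ∑ i, |c i v| * b := by
          refine (Finset.abs_sum_le_sum_abs _ _).trans (Finset.sum_le_sum fun i _ => ?_)
          rw [abs_mul]
          gcongr
          exact hJ i
      _ = (∑ i, |c i v|) * b := by rw [Finset.sum_mul]
      _ ≤ B * b := by gcongr; exact hB' v hv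
  set k := 2 * s + 3 with hk
  have hk0 : 0 ≤ k := by positivity
  refine ⟨(2 + B) * (1 + 5 * M) ^ k +
    (s * (s + 1) * (1 / 2) ^ (-k) + C₀ * M ^ 3 * (1 + B)) * (1 / 2) ^ (-k), by positivity, ?_⟩
  intro p v hp hv
  have hpv0 : 0 < 1 + ‖p + v‖ := by positivity
  have hpv1 : ‖p + v‖ ≤ ‖p‖ + ‖v‖ := norm_add_le _ _
  have hpv2 : ‖p‖ - ‖v‖ ≤ ‖p + v‖ := norm_sub_le_norm_add _ _
  rw [add_mul]
  -- For bounded `p` both terms are bounded, the nodes `p + w i` staying outside the unit ball, and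
  -- the right side is bounded below. For `‖p‖ ≥ 4 * M` the Taylor bound covers all displacements up
  -- to `M`, and `‖p‖` dominates `(1 + ‖p + v‖) / 2`.
  rcases le_total ‖p‖ (4 * M) with h | h
  · refine le_add_of_le_of_nonneg ?_ (by positivity)
    have h1 : |regPot s (p + v)| ≤ 2 := by
      have a0 := pot_nonneg (s := s) zero_le_one (p + v)
      have a1 := pot_le_one (t := 1) hs (x := p + v) (by linarith [sq_nonneg ‖p + v‖])
      have b0 := pot_nonneg (s := s) zero_le_two (p + v)
      have b1 := pot_le_one (t := 2) hs (x := p + v) (by linarith [sq_nonneg ‖p + v‖])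
      rw [regPot, abs_le]
      constructor <;> linarith
    have h2 := hsum v (fun i => pot s 0 (p + w i)) 1 hv zero_le_one fun i => by
      have hn : ‖p‖ - ‖w i‖ ≤ ‖p + w i‖ := norm_sub_le_norm_add _ _
      have hn1 : 1 ≤ ‖p + w i‖ := by linarith [hw i]
      rw [abs_of_nonneg (pot_nonneg le_rfl _)]
      exact pot_le_one hs (by nlinarith)
    have h3 : 1 ≤ (1 + 5 * M) ^ k * (1 + ‖p + v‖) ^ (-k) := by
      rw [Real.rpow_neg hpv0.le, ← div_eq_mul_inv, one_le_div (by positivity)]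
      gcongr
      linarith
    calc _ ≤ |regPot s (p + v)| + |∑ i, c i v * pot s 0 (p + w i)| := abs_sub _ _
      _ ≤ (2 + B) * 1 := by linarith
      _ ≤ (2 + B) * ((1 + 5 * M) ^ k * (1 + ‖p + v‖) ^ (-k)) := by gcongr
      _ = _ := by ring
  · refine le_add_of_nonneg_of_le (by positivity) ?_
    have hp0 : p ≠ 0 := norm_pos_iff.1 (by linarith)
    obtain ⟨α, β, γ, ε, hJ⟩ := hT p hp0
    set T : EuclideanSpace ℝ (Fin d) → ℝ := fun u =>
      α + β * inner ℝ p u + γ * inner ℝ p u ^ 2 + ε * ‖u‖ ^ 2 with hTdef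
    have hJM : ∀ u : EuclideanSpace ℝ (Fin d), ‖u‖ ≤ M →
        |pot s 0 (p + u) - T u| ≤ C₀ * M ^ 3 * ‖p‖ ^ (-k) := by
      intro u hu
      refine (hJ u (by linarith)).trans ?_
      gcongr
    have h1 : |regPot s (p + v) - pot s 0 (p + v)| ≤
        s * (s + 1) * ((1 / 2) ^ (-k) * ‖p‖ ^ (-k)) := by
      refine (abs_pot_regularized_sub_le hs (by linarith)).trans ?_
      gcongr
      rw [← Real.mul_rpow (by norm_num) (by positivity)]
      exact Real.rpow_le_rpow_of_nonpos (by linarith) (by linarith) (by linarith)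
    have h2 := hsum v (fun i => pot s 0 (p + w i) - T (w i)) _ hv (by positivity)
      fun i => hJM (w i) ((hw i).trans hM)
    have h3 : ∑ i, c i v * (pot s 0 (p + w i) - T (w i)) =
        ∑ i, c i v * pot s 0 (p + w i) - T v := by
      simp only [mul_sub, Finset.sum_sub_distrib]
      rw [hwc]
    have h4 : ‖p‖ ^ (-k) ≤ (1 / 2) ^ (-k) * (1 + ‖p + v‖) ^ (-k) := by
      rw [← Real.mul_rpow (by norm_num) (by positivity)]
      exact Real.rpow_le_rpow_of_nonpos (by positivity) (by linarith) (by linarith)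
    rw [h3] at h2
    calc _ = |(regPot s (p + v) - pot s 0 (p + v)) + (pot s 0 (p + v) - T v) -
          (∑ i, c i v * pot s 0 (p + w i) - T v)| := by ring_nf
      _ ≤ |regPot s (p + v) - pot s 0 (p + v)| + |pot s 0 (p + v) - T v| +
          |∑ i, c i v * pot s 0 (p + w i) - T v| :=
        (abs_sub _ _).trans (add_le_add_left (abs_add_le _ _) _)
      _ ≤ s * (s + 1) * ((1 / 2) ^ (-k) * ‖p‖ ^ (-k)) + C₀ * M ^ 3 * ‖p‖ ^ (-k) +
          B * (C₀ * M ^ 3 * ‖p‖ ^ (-k)) := add_le_add (add_le_add h1 (hJM v hv)) h2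
      _ = (s * (s + 1) * (1 / 2) ^ (-k) + C₀ * M ^ 3 * (1 + B)) * ‖p‖ ^ (-k) := by ring
      _ ≤ (s * (s + 1) * (1 / 2) ^ (-k) + C₀ * M ^ 3 * (1 + B)) *
          ((1 / 2) ^ (-k) * (1 + ‖p + v‖) ^ (-k)) := by gcongr
      _ = _ := by ring

/-- The Laplacian of `regPot s`. -/
noncomputable def regDensity {d : ℕ} (s : ℝ) (x : EuclideanSpace ℝ (Fin d)) : ℝ :=
  -(8 * s * (s + 1)) * (pot (s + 2) 1 x - pot (s + 2) 2 x)

theorem contDiff_regPot {n : WithTop ℕ∞} :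
    ContDiff ℝ n (regPot s : EuclideanSpace ℝ (Fin d) → ℝ) :=
  (contDiff_const.mul (contDiff_pot one_pos)).sub (contDiff_pot two_pos)

theorem continuous_regDensity : Continuous (regDensity s : EuclideanSpace ℝ (Fin d) → ℝ) :=
  continuous_const.mul
    ((contDiff_pot one_pos (n := 0)).continuous.sub (contDiff_pot two_pos (n := 0)).continuous)

theorem laplacian_regPot (hs : (d : ℝ) = 2 * s + 2) (x : EuclideanSpace ℝ (Fin d)) :
    Δ (regPot s) x = regDensity s x := by
  have h1 : ContDiffAt ℝ 2 (pot s 1) x := (contDiff_pot one_pos).contDiffAt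
  have h2 : ContDiffAt ℝ 2 (pot s 2) x := (contDiff_pot two_pos).contDiffAt
  have e : (regPot s : EuclideanSpace ℝ (Fin d) → ℝ) = (2 : ℝ) • pot s 1 - pot s 2 := rfl
  have e2 : -(s + 2) = -s - 2 := by ring
  have h3 : ContDiffAt ℝ 2 ((2 : ℝ) • pot s 1) x := h1.const_smul (2 : ℝ)
  rw [e, h3.laplacian_sub h2,
    InnerProductSpace.laplacian_smul _ h1,
    laplacian_pot hs (by positivity) one_pos.le, laplacian_pot hs (by positivity) two_pos.le,
    regDensity, pot, pot, e2]
  simp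
  ring

theorem integrable_pot (hs : (d : ℝ) < 2 * s) :
    Integrable (pot s 1 : EuclideanSpace ℝ (Fin d) → ℝ) := by
  have := integrable_rpow_neg_one_add_norm_sq (E := EuclideanSpace ℝ (Fin d)) (μ := volume)
    (r := 2 * s) (by simpa using hs)
  refine this.congr (ae_of_all _ fun x => ?_)
  simp only [pot, add_comm]
  congr 1
  ring

theorem pot_two_eq (x : EuclideanSpace ℝ (Fin d)) :
    pot s 2 x = 2 ^ (-s) * pot s 1 ((√2)⁻¹ • x) := by
  simp only [pot]
  rw [← Real.mul_rpow (by norm_num) (by positivity), norm_smul, mul_pow]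
  congr 1
  simp
  ring

theorem integrable_pot_two (hs : (d : ℝ) < 2 * s) :
    Integrable (pot s 2 : EuclideanSpace ℝ (Fin d) → ℝ) := by
  rw [show (pot s 2 : EuclideanSpace ℝ (Fin d) → ℝ) = _ from funext pot_two_eq]
  exact ((integrable_pot hs).comp_smul (by positivity)).const_mul _

/-- By scaling, the integral of `pot (s + 2) 2` is half that of `pot (s + 2) 1`, so their difference
has positive integral. -/
theorem integral_regDensity_ne_zero (hs : (d : ℝ) = 2 * s + 2) (hs0 : 0 < s) :
    ∫ x : EuclideanSpace ℝ (Fin d), regDensity s x ≠ 0 := by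
  have hd : (d : ℝ) < 2 * (s + 2) := by linarith
  have h2 : ∫ x : EuclideanSpace ℝ (Fin d), pot (s + 2) 2 x =
      1 / 2 * ∫ x : EuclideanSpace ℝ (Fin d), pot (s + 2) 1 x := by
    simp_rw [pot_two_eq]
    -- The factor is `2 ^ (-(s + 2)) * √2 ^ d` with `d = 2 s + 2`, that is 1/2.
    rw [integral_const_mul, Measure.integral_comp_smul, finrank_euclideanSpace_fin, smul_eq_mul,
      ← mul_assoc]
    congr 1
    rw [← inv_pow, inv_inv, abs_of_nonneg (by positivity), Real.sqrt_eq_rpow, ← Real.rpow_natCast,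
      ← Real.rpow_mul (by norm_num), ← Real.rpow_add (by norm_num), hs]
    ring_nf
    norm_num [Real.rpow_neg_one]
  have hpos : 0 < ∫ x : EuclideanSpace ℝ (Fin d), pot (s + 2) 1 x := by
    refine integral_pos_of_integrable_nonneg_nonzero (x := 0)
      (contDiff_pot one_pos (n := 0)).continuous (integrable_pot hd) (pot_nonneg zero_le_one) ?_
    simp [pot]
  simp only [regDensity]
  rw [integral_const_mul, integral_sub (integrable_pot hd) (integrable_pot_two hd), h2]
  refine mul_ne_zero (by simp; constructor <;> linarith) ?_
  linarith

/-- The density decays at least like `|x|^(-(d + 2))`, so one factor of linear growth is affordable.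
That factor absorbs the linear growth of the oscillation of `f`. -/
theorem integrable_two_add_norm_mul_regDensity (hs : (d : ℝ) = 2 * s + 2) (hs0 : 0 < s) :
    Integrable fun x : EuclideanSpace ℝ (Fin d) => (2 + ‖x‖) * |regDensity s x| := by
  have h1 := (integrable_one_add_norm (E := EuclideanSpace ℝ (Fin d)) (μ := volume)
    (r := 2 * s + 3) (by simp [hs]; linarith)).const_mul (2 * (8 * s * (s + 1) * 2 ^ (s + 2)))
  have hcont : Continuous fun x : EuclideanSpace ℝ (Fin d) => (2 + ‖x‖) * |regDensity s x| :=
    (continuous_const.add continuous_norm).mul continuous_regDensity.abs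
  refine h1.mono' hcont.aestronglyMeasurable (ae_of_all _ fun x => ?_)
  have hx : 0 < 1 + ‖x‖ := by positivity
  have h2 : |regDensity s x| ≤ 8 * s * (s + 1) * pot (s + 2) 1 x := by
    have h3 : 0 ≤ pot (s + 2) 2 x := pot_nonneg zero_le_two x
    have h4 : pot (s + 2) 2 x ≤ pot (s + 2) 1 x :=
      Real.rpow_le_rpow_of_nonpos (by positivity) (by linarith) (by linarith)
    rw [regDensity, abs_mul, abs_neg, abs_of_nonneg (by positivity),
      abs_of_nonneg (by linarith)]
    gcongr
    linarith
  have h5 : pot (s + 2) 1 x ≤ 2 ^ (s + 2) * (1 + ‖x‖) ^ (-(2 * s + 4)) := by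
    have h := rpow_neg_one_add_norm_sq_le x (r := 2 * s + 4) (by linarith)
    rwa [show -(2 * s + 4) / 2 = -(s + 2) by ring, show (2 * s + 4) / 2 = s + 2 by ring,
      add_comm 1 (‖x‖ ^ 2)] at h
  have h6 : (1 + ‖x‖) ^ (-(2 * s + 4)) * (1 + ‖x‖) = (1 + ‖x‖) ^ (-(2 * s + 3)) := by
    rw [← Real.rpow_add_one hx.ne']
    congr 1
    ring
  rw [Real.norm_eq_abs, abs_of_nonneg (by positivity)]
  calc (2 + ‖x‖) * |regDensity s x|
      ≤ (2 * (1 + ‖x‖)) * (8 * s * (s + 1) * (2 ^ (s + 2) * (1 + ‖x‖) ^ (-(2 * s + 4)))) := by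
        refine mul_le_mul (by linarith [norm_nonneg x]) (h2.trans ?_) (abs_nonneg _)
          (by positivity)
        gcongr
    _ = 2 * (8 * s * (s + 1) * 2 ^ (s + 2)) * ((1 + ‖x‖) ^ (-(2 * s + 4)) * (1 + ‖x‖)) := by ring
    _ = _ := by rw [h6]

end Kernel

/-! ### Green's identity and approximation by potentials of bounded density. -/

section Convolution

variable {d : ℕ} {s : ℝ}

theorem laplacian_eq_sum_fderiv (g : EuclideanSpace ℝ (Fin d) → ℝ)
    (x : EuclideanSpace ℝ (Fin d)) :
    Δ g x = ∑ i, fderiv ℝ (fderiv ℝ g) x (EuclideanSpace.single i 1)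
      (EuclideanSpace.single i 1) := by
  rw [InnerProductSpace.laplacian_eq_iteratedFDeriv_orthonormalBasis _
    (EuclideanSpace.basisFun (Fin d) ℝ)]
  simp [iteratedFDeriv_two_apply]

theorem laplacian_comp_sub (g : EuclideanSpace ℝ (Fin d) → ℝ) (a x : EuclideanSpace ℝ (Fin d)) :
    (Δ (fun y => g (y - a)) : EuclideanSpace ℝ (Fin d) → ℝ) x = Δ g (x - a) := by
  rw [InnerProductSpace.laplacian_eq_iteratedFDeriv_stdOrthonormalBasis,
    InnerProductSpace.laplacian_eq_iteratedFDeriv_stdOrthonormalBasis]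
  simp only [iteratedFDeriv_comp_sub]

theorem continuous_laplacian {g : EuclideanSpace ℝ (Fin d) → ℝ} (hg : ContDiff ℝ 2 g) :
    Continuous (Δ g) := by
  have h : Continuous (fderiv ℝ (fderiv ℝ g)) :=
    (hg.fderiv_right (m := 1) (by norm_num)).continuous_fderiv (by norm_num)
  rw [funext (laplacian_eq_sum_fderiv g)]
  fun_prop

theorem tsupport_laplacian_subset (g : EuclideanSpace ℝ (Fin d) → ℝ) :
    tsupport (Δ g) ⊆ tsupport g := by
  refine closure_minimal (fun x hx => ?_) (isClosed_tsupport g)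
  by_contra h
  refine hx ?_
  rw [laplacian_eq_sum_fderiv]
  have : fderiv ℝ (fderiv ℝ g) x = 0 := image_eq_zero_of_notMem_tsupport fun h' =>
    h (tsupport_fderiv_subset ℝ (tsupport_fderiv_subset ℝ h'))
  simp [this]

/-- Green's identity for a compactly supported function. -/
theorem integral_laplacian_mul {χ g : EuclideanSpace ℝ (Fin d) → ℝ} (hχ : ContDiff ℝ 2 χ)
    (hc : HasCompactSupport χ) (hg : ContDiff ℝ 2 g) :
    ∫ x, Δ χ x * g x = ∫ x, χ x * Δ g x := by
  have dχ : ContDiff ℝ 1 (fderiv ℝ χ) := hχ.fderiv_right (by norm_num)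
  have dg : ContDiff ℝ 1 (fderiv ℝ g) := hg.fderiv_right (by norm_num)
  have ddχ : Continuous (fderiv ℝ (fderiv ℝ χ)) := dχ.continuous_fderiv (by norm_num)
  have ddg : Continuous (fderiv ℝ (fderiv ℝ g)) := dg.continuous_fderiv (by norm_num)
  have c0 := hχ.continuous
  have c1 := dχ.continuous
  have e0 := hg.continuous
  have e1 := dg.continuous
  have s1 := hc.fderiv (𝕜 := ℝ)
  have s2 := s1.fderiv (𝕜 := ℝ)
  have i0 (u : EuclideanSpace ℝ (Fin d) → ℝ) (hu : Continuous u) :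
      Integrable fun x => χ x * u x :=
    (c0.mul hu).integrable_of_hasCompactSupport hc.mul_right
  have s1v (v : EuclideanSpace ℝ (Fin d)) : HasCompactSupport fun x => fderiv ℝ χ x v :=
    s1.comp_left (g := fun l : EuclideanSpace ℝ (Fin d) →L[ℝ] ℝ => l v) (by simp)
  have s2v (v : EuclideanSpace ℝ (Fin d)) :
      HasCompactSupport fun x => fderiv ℝ (fderiv ℝ χ) x v v :=
    s2.comp_left (g := fun l : EuclideanSpace ℝ (Fin d) →L[ℝ] EuclideanSpace ℝ (Fin d) →L[ℝ] ℝ =>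
      l v v) (by simp)
  have i1 (v : EuclideanSpace ℝ (Fin d)) (u : EuclideanSpace ℝ (Fin d) → ℝ) (hu : Continuous u) :
      Integrable fun x => fderiv ℝ χ x v * u x :=
    ((c1.clm_apply continuous_const).mul hu).integrable_of_hasCompactSupport (s1v v).mul_right
  have i2 (v : EuclideanSpace ℝ (Fin d)) (u : EuclideanSpace ℝ (Fin d) → ℝ) (hu : Continuous u) :
      Integrable fun x => fderiv ℝ (fderiv ℝ χ) x v v * u x :=
    (((ddχ.clm_apply continuous_const).clm_apply continuous_const).mul
      hu).integrable_of_hasCompactSupport (s2v v).mul_right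
  have f1 (w : EuclideanSpace ℝ (Fin d) → ℝ) (hw : ContDiff ℝ 1 (fderiv ℝ w))
      (v x : EuclideanSpace ℝ (Fin d)) :
      fderiv ℝ (fun y => fderiv ℝ w y v) x v = fderiv ℝ (fderiv ℝ w) x v v := by
    rw [fderiv_clm_apply (hw.differentiable (by norm_num) x) (differentiableAt_const v)]
    simp
  have key (v : EuclideanSpace ℝ (Fin d)) : ∫ x, fderiv ℝ (fderiv ℝ χ) x v v * g x =
      ∫ x, χ x * fderiv ℝ (fderiv ℝ g) x v v := by
    have hdg := i0 (fun x => fderiv ℝ (fderiv ℝ g) x v v)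
      ((ddg.clm_apply continuous_const).clm_apply continuous_const)
    have a1 := integral_mul_fderiv_eq_neg_fderiv_mul_of_integrable (μ := volume)
      (f := fun x => fderiv ℝ χ x v) (g := g) (v := v)
      (by simpa only [f1 χ dχ] using i2 v g e0)
      (i1 v _ (e1.clm_apply continuous_const)) (i1 v g e0)
      (fun x _ => ((dχ.differentiable (by norm_num)).clm_apply (differentiable_const v)) x)
      (fun x _ => hg.differentiable (by norm_num) x)
    have a2 := integral_mul_fderiv_eq_neg_fderiv_mul_of_integrable (μ := volume)
      (f := χ) (g := fun x => fderiv ℝ g x v) (v := v)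
      (i1 v _ (e1.clm_apply continuous_const))
      (by simpa only [f1 g dg] using hdg)
      (i0 _ (e1.clm_apply continuous_const))
      (fun x _ => hχ.differentiable (by norm_num) x)
      (fun x _ => ((dg.differentiable (by norm_num)).clm_apply (differentiable_const v)) x)
    simp only [f1 χ dχ, f1 g dg] at a1 a2
    linarith
  simp only [laplacian_eq_sum_fderiv, Finset.sum_mul, Finset.mul_sum]
  rw [integral_finsetSum _ fun i _ => i2 _ g e0, integral_finsetSum _ fun i _ => i0 _
    ((ddg.clm_apply continuous_const).clm_apply continuous_const)]
  exact Finset.sum_congr rfl fun i _ => key _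

theorem convolution_assoc_of_hasCompactSupport {f g k : EuclideanSpace ℝ (Fin d) → ℝ}
    (hf : Continuous f) (hcf : HasCompactSupport f) (hg : Continuous g)
    (hcg : HasCompactSupport g) (hk : Continuous k) (x : EuclideanSpace ℝ (Fin d)) :
    ((f ⋆[ContinuousLinearMap.mul ℝ ℝ] g) ⋆[ContinuousLinearMap.mul ℝ ℝ] k) x =
      (f ⋆[ContinuousLinearMap.mul ℝ ℝ] (g ⋆[ContinuousLinearMap.mul ℝ ℝ] k)) x := by
  refine convolution_assoc _ _ _ _ (fun a b c => by simp [mul_assoc]) hf.aestronglyMeasurable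
    hg.aestronglyMeasurable hk.aestronglyMeasurable
    (ae_of_all _ (hcf.convolutionExists_left _ hf hg.locallyIntegrable))
    (ae_of_all _ (hcg.norm.convolutionExists_left _ hg.norm hk.norm.locallyIntegrable))
    (hcf.norm.convolutionExists_left _ hf.norm ?_ x)
  exact (hcg.norm.continuous_convolution_left _ hg.norm
    hk.norm.locallyIntegrable).locallyIntegrable

theorem regPot_neg (x : EuclideanSpace ℝ (Fin d)) : regPot s (-x) = regPot s x := by
  simp [regPot, pot]

theorem regDensity_neg (x : EuclideanSpace ℝ (Fin d)) : regDensity s (-x) = regDensity s x := by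
  simp [regDensity, pot]

theorem laplacian_convolution_regPot (hs : (d : ℝ) = 2 * s + 2)
    {χ : EuclideanSpace ℝ (Fin d) → ℝ} (hχ : ContDiff ℝ 2 χ) (hc : HasCompactSupport χ) :
    (Δ χ) ⋆[ContinuousLinearMap.mul ℝ ℝ] (regPot s) =
      χ ⋆[ContinuousLinearMap.mul ℝ ℝ] (regDensity s) := by
  ext p
  have h (t : EuclideanSpace ℝ (Fin d)) :
      (Δ (fun t => regPot s (p - t)) : EuclideanSpace ℝ (Fin d) → ℝ) t = regDensity s (p - t) := by
    have e : (fun t => regPot s (p - t)) = fun t => regPot s (t - p) := by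
      ext t
      rw [← regPot_neg, neg_sub]
    rw [e, ← regDensity_neg, neg_sub, ← laplacian_regPot hs, laplacian_comp_sub]
  simp only [convolution_def, ContinuousLinearMap.mul_apply']
  have hg : ContDiff ℝ 2 fun t : EuclideanSpace ℝ (Fin d) => regPot s (p - t) :=
    contDiff_regPot.comp (contDiff_const.sub contDiff_id)
  rw [integral_laplacian_mul hχ hc hg]
  simp only [h]

/-- Here `κ = ∫ regDensity s` and `h = f * Δχ`. Only the oscillation of `f` at scales at least one
enters, never its derivatives or the size of its support. -/
theorem exists_potential_approximation (hs : (d : ℝ) = 2 * s + 2) (hs0 : 0 < s) :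
    ∃ κ C : ℝ, κ ≠ 0 ∧ 0 ≤ C ∧ ∀ f : EuclideanSpace ℝ (Fin d) → ℝ, Continuous f →
      HasCompactSupport f → ∀ A : ℝ, 0 ≤ A → (∀ x y, |f x - f y| ≤ A * max 1 (dist x y)) →
      ∃ h : EuclideanSpace ℝ (Fin d) → ℝ, Continuous h ∧ HasCompactSupport h ∧
        (∀ y, |h y| ≤ C * A) ∧ ∀ x, |(∫ y, h y * regPot s (x - y)) - κ * f x| ≤ C * A := by
  let b : ContDiffBump (0 : EuclideanSpace ℝ (Fin d)) := ⟨1 / 2, 1, by norm_num, by norm_num⟩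
  set χ : EuclideanSpace ℝ (Fin d) → ℝ := b.normed volume with hχdef
  have hχ : ContDiff ℝ 2 χ := b.contDiff_normed
  have hc : HasCompactSupport χ := b.hasCompactSupport_normed
  have hts : tsupport χ = Metric.closedBall 0 1 := b.tsupport_normed_eq
  have hχ1 : ∫ x, χ x = 1 := b.integral_normed
  have hχ0 : ∀ x, 0 ≤ χ x := b.nonneg_normed
  have hχi : Integrable χ := b.integrable_normed
  have hL : Continuous (Δ χ) := continuous_laplacian hχ
  have hcL : HasCompactSupport (Δ χ) := hc.of_isClosed_subset (isClosed_tsupport _)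
    (tsupport_laplacian_subset χ)
  have hLi : Integrable (Δ χ) := hL.integrable_of_hasCompactSupport hcL
  have hL0 : ∫ x, Δ χ x = 0 := by
    have := integral_laplacian_mul hχ hc (g := fun _ => (1 : ℝ)) contDiff_const
    simpa [InnerProductSpace.laplacian_const] using this
  have hsmall : ∀ (u : EuclideanSpace ℝ (Fin d) → ℝ), tsupport u ⊆ tsupport χ →
      ∀ t, u t ≠ 0 → ‖t‖ ≤ 1 := fun u hu t ht => by
    have := hu (subset_tsupport u ht)
    rw [hts] at this
    simpa using this
  refine ⟨∫ x : EuclideanSpace ℝ (Fin d), regDensity s x,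
    (∫ x, |Δ χ x|) + ∫ x : EuclideanSpace ℝ (Fin d), (2 + ‖x‖) * |regDensity s x|,
    integral_regDensity_ne_zero hs hs0,
    add_nonneg (integral_nonneg fun _ => abs_nonneg _)
      (integral_nonneg fun _ => by positivity), ?_⟩
  intro f hf hcf A hA hfA
  have hI1 : 0 ≤ ∫ x, |Δ χ x| := integral_nonneg fun _ => abs_nonneg _
  have hI2 : 0 ≤ ∫ x : EuclideanSpace ℝ (Fin d), (2 + ‖x‖) * |regDensity s x| :=
    integral_nonneg fun _ => by positivity
  refine ⟨f ⋆[ContinuousLinearMap.mul ℝ ℝ] (Δ χ),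
    hcf.continuous_convolution_left _ hf hL.locallyIntegrable, hcf.convolution _ hcL, ?_, ?_⟩
  · intro y
    have hint : Integrable fun t => f (y - t) * Δ χ t :=
      ((hf.comp (continuous_const.sub continuous_id)).mul hL).integrable_of_hasCompactSupport
        hcL.mul_left
    -- As `Δχ` has mean zero, `f y` may be subtracted; on the unit ball the oscillation is at most
    -- `A`.
    have e : (f ⋆[ContinuousLinearMap.mul ℝ ℝ] (Δ χ)) y = ∫ t, (f (y - t) - f y) * Δ χ t := by
      rw [convolution_eq_swap]
      simp only [ContinuousLinearMap.mul_apply', sub_mul]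
      rw [integral_sub hint (hLi.const_mul _), integral_const_mul, hL0]
      simp
    rw [e, add_mul]
    refine le_add_of_le_of_nonneg ?_ (by positivity)
    rw [mul_comm, ← integral_const_mul, ← Real.norm_eq_abs]
    refine norm_integral_le_of_norm_le (hLi.abs.const_mul A) (ae_of_all _ fun t => ?_)
    rw [norm_mul, Real.norm_eq_abs, Real.norm_eq_abs]
    by_cases ht : Δ χ t = 0
    · simp [ht]
    · have h1 := hsmall _ (tsupport_laplacian_subset χ) t ht
      have h2 := hfA (y - t) y
      rw [dist_eq_norm, sub_sub_cancel_left, norm_neg, max_eq_left h1, mul_one] at h2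
      gcongr
  · intro x
    have hfχ : Continuous (f ⋆[ContinuousLinearMap.mul ℝ ℝ] χ) :=
      hcf.continuous_convolution_left _ hf hχ.continuous.locallyIntegrable
    -- Associativity twice: `(f * Δχ) * regPot = f * (Δχ * regPot) = f * (χ * regDensity) = (f * χ)
    -- * regDensity`.
    have e : ∫ y, (f ⋆[ContinuousLinearMap.mul ℝ ℝ] (Δ χ)) y * regPot s (x - y) =
        ∫ z, (f ⋆[ContinuousLinearMap.mul ℝ ℝ] χ) (x - z) * regDensity s z := by
      have e1 := convolution_assoc_of_hasCompactSupport hf hcf hL hcL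
        (contDiff_regPot (s := s) (n := 0)).continuous x
      have e2 := convolution_assoc_of_hasCompactSupport hf hcf hχ.continuous hc
        (continuous_regDensity (s := s)) x
      rw [laplacian_convolution_regPot hs hχ hc, ← e2, convolution_def] at e1
      refine e1.trans ?_
      rw [convolution_eq_swap]
      rfl
    have hclose : ∀ z, |(f ⋆[ContinuousLinearMap.mul ℝ ℝ] χ) (x - z) - f x| ≤ A * (2 + ‖z‖) := by
      intro z
      have hint : Integrable fun t => f (x - z - t) * χ t :=
        ((hf.comp (continuous_const.sub continuous_id)).mul
          hχ.continuous).integrable_of_hasCompactSupport hc.mul_left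
      have e' : (f ⋆[ContinuousLinearMap.mul ℝ ℝ] χ) (x - z) - f x =
          ∫ t, (f (x - z - t) - f x) * χ t := by
        rw [convolution_eq_swap]
        simp only [ContinuousLinearMap.mul_apply', sub_mul]
        rw [integral_sub hint (hχi.const_mul _), integral_const_mul, hχ1, mul_one]
      rw [e']
      have : ∫ t, A * (2 + ‖z‖) * χ t = A * (2 + ‖z‖) := by
        rw [integral_const_mul, hχ1, mul_one]
      rw [← this, ← Real.norm_eq_abs]
      refine norm_integral_le_of_norm_le (hχi.const_mul _) (ae_of_all _ fun t => ?_)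
      rw [norm_mul, Real.norm_eq_abs, Real.norm_eq_abs, abs_of_nonneg (hχ0 t)]
      by_cases ht : χ t = 0
      · simp [ht]
      · have h1 := hsmall _ subset_rfl t ht
        have h2 := hfA (x - z - t) x
        have h3 : max 1 (dist (x - z - t) x) ≤ 2 + ‖z‖ := by
          rw [dist_eq_norm, show x - z - t - x = -(z + t) by abel, norm_neg]
          have := norm_add_le z t
          exact max_le (by linarith [norm_nonneg z]) (by linarith)
        have h4 := hχ0 t
        exact mul_le_mul_of_nonneg_right (h2.trans (by gcongr)) h4
    have hP := integrable_two_add_norm_mul_regDensity hs hs0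
    have hPi : Integrable (regDensity s : EuclideanSpace ℝ (Fin d) → ℝ) :=
      hP.mono' continuous_regDensity.aestronglyMeasurable (ae_of_all _ fun z => by
        rw [Real.norm_eq_abs]
        exact le_mul_of_one_le_left (abs_nonneg _) (by linarith [norm_nonneg z]))
    have hbd : ∀ z, ‖((f ⋆[ContinuousLinearMap.mul ℝ ℝ] χ) (x - z) - f x) * regDensity s z‖ ≤
        A * ((2 + ‖z‖) * |regDensity s z|) := fun z => by
      rw [norm_mul, Real.norm_eq_abs, Real.norm_eq_abs, ← mul_assoc]
      exact mul_le_mul_of_nonneg_right (hclose z) (abs_nonneg _)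
    have hint : Integrable fun z =>
        ((f ⋆[ContinuousLinearMap.mul ℝ ℝ] χ) (x - z) - f x) * regDensity s z :=
      (hP.const_mul A).mono' ((((hfχ.comp (continuous_const.sub continuous_id)).sub
        continuous_const).mul continuous_regDensity).aestronglyMeasurable) (ae_of_all _ hbd)
    have e3 : (∫ z, (f ⋆[ContinuousLinearMap.mul ℝ ℝ] χ) (x - z) * regDensity s z) -
        (∫ z : EuclideanSpace ℝ (Fin d), regDensity s z) * f x =
        ∫ z, ((f ⋆[ContinuousLinearMap.mul ℝ ℝ] χ) (x - z) - f x) * regDensity s z := by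
      rw [sub_eq_iff_eq_add, mul_comm, ← integral_const_mul,
        ← integral_add hint (hPi.const_mul _)]
      congr 1 with z
      ring
    rw [e, e3, add_mul]
    refine le_add_of_nonneg_of_le (by positivity) ?_
    rw [mul_comm, ← integral_const_mul, ← Real.norm_eq_abs]
    exact norm_integral_le_of_norm_le (hP.const_mul A) (ae_of_all _ hbd)

end Convolution

/-! ### Moving the poles away from `K` and summing. -/

section Poles

variable {d : ℕ} {s : ℝ}

/-- The linear combinations of Newtonian kernels with poles at distance at least `2` from `K`. -/
noncomputable def poleSpan {d : ℕ} (s : ℝ) (K : Set (EuclideanSpace ℝ (Fin d))) :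
    Submodule ℝ (EuclideanSpace ℝ (Fin d) → ℝ) :=
  Submodule.span ℝ {g | ∃ a, (∀ k ∈ K, 2 ≤ dist a k) ∧ g = fun x => pot s 0 (x - a)}

/-- Each `y` is sent to its nearest point in a finite set forming a 1-net of `S`, and then to a good
point near that one. Finitely many measurable fibres result, as the passage from an integral to a
finite sum requires. -/
theorem exists_simpleFunc_dist_le {S : Set (EuclideanSpace ℝ (Fin d))} (hS : IsCompact S) {M : ℝ}
    {P : EuclideanSpace ℝ (Fin d) → Prop} (hP : ∀ x, ∃ z, dist x z ≤ M ∧ P z) :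
    ∃ Z : SimpleFunc (EuclideanSpace ℝ (Fin d)) (EuclideanSpace ℝ (Fin d)),
      (∀ y, P (Z y)) ∧ ∀ y ∈ S, dist y (Z y) ≤ M + 1 := by
  choose z hz hPz using hP
  set e := TopologicalSpace.denseSeq (EuclideanSpace ℝ (Fin d))
  obtain ⟨t, ht⟩ := hS.elim_finite_subcover (fun n => Metric.ball (e n) 1)
    (fun n => Metric.isOpen_ball) fun x _ => by
      obtain ⟨n, hn⟩ := (TopologicalSpace.denseRange_denseSeq _).exists_dist_lt x one_pos
      exact mem_iUnion.2 ⟨n, hn⟩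
  refine ⟨(SimpleFunc.nearestPt e (t.sup id)).map z, fun y => hPz _, fun y hy => ?_⟩
  obtain ⟨n, hn, hyn⟩ := mem_iUnion₂.1 (ht hy)
  have h1 := SimpleFunc.edist_nearestPt_le e y (Finset.le_sup (f := id) hn)
  rw [edist_dist, edist_dist, ENNReal.ofReal_le_ofReal_iff dist_nonneg] at h1
  rw [id, dist_comm (e n) y] at h1
  have h2 : dist y (e n) < 1 := hyn
  have h3 := hz (SimpleFunc.nearestPt e (t.sup id) y)
  have h4 := dist_triangle y (SimpleFunc.nearestPt e (t.sup id) y)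
    (z (SimpleFunc.nearestPt e (t.sup id) y))
  rw [dist_comm y (SimpleFunc.nearestPt e (t.sup id) y)] at h4
  simp only [SimpleFunc.map_apply]
  linarith

theorem integral_mul_sum_eq {h : EuclideanSpace ℝ (Fin d) → ℝ} (hh : Continuous h)
    (hch : HasCompactSupport h) {ι : Type} [Fintype ι]
    {c : ι → EuclideanSpace ℝ (Fin d) → ℝ} (hc : ∀ i, Continuous (c i))
    (Z : SimpleFunc (EuclideanSpace ℝ (Fin d)) (EuclideanSpace ℝ (Fin d)))
    (q : ι → EuclideanSpace ℝ (Fin d) → ℝ) :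
    Integrable (fun y => h y * ∑ i, c i (Z y - y) * q i (Z y)) ∧
      ∫ y, h y * ∑ i, c i (Z y - y) * q i (Z y) =
        ∑ k ∈ Z.range, ∑ i, (∫ y in Z ⁻¹' {k}, h y * c i (k - y)) * q i k := by
  have e : (fun y => h y * ∑ i, c i (Z y - y) * q i (Z y)) = fun y => ∑ k ∈ Z.range, ∑ i,
      (Z ⁻¹' {k}).indicator (fun y => h y * c i (k - y)) y * q i k := by
    ext y
    rw [Finset.sum_eq_single (Z y), Finset.mul_sum]
    · refine Finset.sum_congr rfl fun i _ => ?_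
      rw [indicator_of_mem (by simp)]
      ring
    · intro k _ hk
      refine Finset.sum_eq_zero fun i _ => ?_
      rw [indicator_of_notMem (by simpa using hk.symm), zero_mul]
    · exact fun hy => (hy (Z.mem_range_self y)).elim
  have hint (k : EuclideanSpace ℝ (Fin d)) (i : ι) :
      Integrable fun y => (Z ⁻¹' {k}).indicator (fun y => h y * c i (k - y)) y * q i k :=
    (((hh.mul ((hc i).comp (continuous_const.sub continuous_id))).integrable_of_hasCompactSupport
      hch.mul_right).indicator (Z.measurableSet_fiber k)).mul_const _
  rw [e]
  refine ⟨integrable_finsetSum _ fun k _ => integrable_finsetSum _ fun i _ => hint k i, ?_⟩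
  rw [integral_finsetSum _ fun k _ => integrable_finsetSum _ fun i _ => hint k i]
  refine Finset.sum_congr rfl fun k _ => ?_
  rw [integral_finsetSum _ fun i _ => hint k i]
  refine Finset.sum_congr rfl fun i _ => ?_
  rw [integral_mul_const, integral_indicator (Z.measurableSet_fiber k)]

/-- The density is at most `C₁ * A` and the error of replacing the kernel is integrable in `y`,
uniformly in `x`; division by `κ` finishes. The constant depends on `K` only through `M`. -/
theorem exists_poleSpan_approximation (hs : (d : ℝ) = 2 * s + 2) (hs0 : 0 < s) {M : ℝ}
    (hM : 2 ≤ M) :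
    ∃ C : ℝ, 0 ≤ C ∧ ∀ K : Set (EuclideanSpace ℝ (Fin d)),
      (∀ x, ∃ z, dist x z ≤ M ∧ ∀ k ∈ K, 4 ≤ dist z k) →
      ∀ f : EuclideanSpace ℝ (Fin d) → ℝ, Continuous f → HasCompactSupport f →
      ∀ A : ℝ, 0 ≤ A → (∀ x y, |f x - f y| ≤ A * max 1 (dist x y)) →
      ∃ G ∈ poleSpan s K, ∀ x ∈ Metric.thickening 1 K, |f x - G x| ≤ C * A := by
  obtain ⟨κ, C₁, hκ, hC₁, happ⟩ := exists_potential_approximation hs hs0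
  obtain ⟨ι, _, w, c, hw, hc, hwc⟩ := exists_interpolation d
  obtain ⟨C₂, hC₂, hker⟩ := exists_abs_regPot_sub_interpolation_le hs0.le
    (show 2 ≤ M + 1 by linarith) hw hc hwc
  have hI : Integrable fun y : EuclideanSpace ℝ (Fin d) => (1 + ‖y‖) ^ (-(2 * s + 3)) :=
    integrable_one_add_norm (by simp [hs]; linarith)
  set I := ∫ y : EuclideanSpace ℝ (Fin d), (1 + ‖y‖) ^ (-(2 * s + 3)) with hIdef
  have hI0 : 0 ≤ I := integral_nonneg fun _ => by positivity
  refine ⟨|κ|⁻¹ * (C₁ + C₁ * C₂ * I), by positivity, ?_⟩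
  intro K hK f hf hcf A hA hfA
  obtain ⟨h, hh, hch, hhA, hfh⟩ := happ f hf hcf A hA hfA
  obtain ⟨Z, hZK, hZ⟩ := exists_simpleFunc_dist_le hch.isCompact hK
  refine ⟨κ⁻¹ • ∑ k ∈ Z.range, ∑ i, (∫ y in Z ⁻¹' {k}, h y * c i (k - y)) •
    fun x => pot s 0 (x - (k - w i)), ?_, ?_⟩
  -- The point `Z y` is at distance at least 4 from `K` and the nodes `w i` have norm at most 2, so
  -- the poles keep distance 2.
  · refine Submodule.smul_mem _ _ (Submodule.sum_mem _ fun k hk => Submodule.sum_mem _ fun i _ =>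
      Submodule.smul_mem _ _ (Submodule.subset_span ⟨k - w i, fun a ha => ?_, rfl⟩))
    obtain ⟨y, rfl⟩ := SimpleFunc.mem_range.1 hk
    have h1 := hZK y a ha
    have h2 := dist_triangle (Z y) (Z y - w i) a
    rw [dist_self_sub_right] at h2
    linarith [hw i]
  · intro x hx
    obtain ⟨k, hk, hxk⟩ := Metric.mem_thickening_iff.1 hx
    obtain ⟨hint, heq⟩ := integral_mul_sum_eq hh hch hc Z fun i z => pot s 0 (x - z + w i)
    have hint' : Integrable fun y => h y * regPot s (x - y) :=
      (hh.mul ((contDiff_regPot (n := 0)).continuous.comp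
        (continuous_const.sub continuous_id))).integrable_of_hasCompactSupport hch.mul_right
    have hG : (κ⁻¹ • ∑ k ∈ Z.range, ∑ i, (∫ y in Z ⁻¹' {k}, h y * c i (k - y)) •
        fun x => pot s 0 (x - (k - w i))) x =
        κ⁻¹ * ∫ y, h y * ∑ i, c i (Z y - y) * pot s 0 (x - Z y + w i) := by
      rw [heq]
      simp [Finset.sum_apply, sub_sub_eq_add_sub, sub_add_eq_add_sub]
    have hbd : |(∫ y, h y * regPot s (x - y)) -
        ∫ y, h y * ∑ i, c i (Z y - y) * pot s 0 (x - Z y + w i)| ≤ C₁ * A * C₂ * I := by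
      rw [← integral_sub hint' hint, hIdef,
        ← integral_sub_left_eq_self (fun y => (1 + ‖y‖) ^ (-(2 * s + 3))) volume x,
        ← integral_const_mul, ← Real.norm_eq_abs]
      refine norm_integral_le_of_norm_le ((hI.comp_sub_left x).const_mul _)
        (ae_of_all _ fun y => ?_)
      rw [← mul_sub, norm_mul, Real.norm_eq_abs, Real.norm_eq_abs]
      by_cases hy : h y = 0
      · rw [hy, abs_zero, zero_mul]
        positivity
      · have hyZ := hZ y (subset_tsupport h hy)
        -- Distance 4 from `k`, less the distance below 1 from `x` to `k`.
        have h3 : 3 ≤ ‖x - Z y‖ := by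
          have h1 := hZK y k hk
          have h2 := dist_triangle_left (Z y) k x
          rw [dist_eq_norm x (Z y)] at h2
          linarith
        have h4 := hker (x - Z y) (Z y - y) h3 (by rwa [← dist_eq_norm, dist_comm])
        rw [sub_add_sub_cancel] at h4
        rw [mul_assoc (C₁ * A)]
        exact mul_le_mul (hhA y) h4 (abs_nonneg _) (by positivity)
    set J := ∫ y, h y * ∑ i, c i (Z y - y) * pot s 0 (x - Z y + w i)
    rw [hG, show f x - κ⁻¹ * J = κ⁻¹ * (κ * f x - J) by field_simp, abs_mul, abs_inv, mul_assoc]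
    gcongr
    have h5 := abs_sub_le (κ * f x) (∫ y, h y * regPot s (x - y)) J
    have h6 := hfh x
    rw [abs_sub_comm] at h6
    linarith

theorem pot_zero_smul (r : ℝ) (x : EuclideanSpace ℝ (Fin d)) :
    pot s 0 (r • x) = (r ^ 2) ^ (-s) * pot s 0 x := by
  simp only [pot, add_zero, norm_smul, mul_pow, Real.norm_eq_abs, sq_abs]
  exact Real.mul_rpow (by positivity) (by positivity)

theorem harmonicAt_pot_sub (hs : (d : ℝ) = 2 * s + 2) {a x : EuclideanSpace ℝ (Fin d)}
    (hx : x ≠ a) : InnerProductSpace.HarmonicAt (fun y => pot s 0 (y - a)) x := by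
  obtain ⟨h1, h2⟩ := harmonicAt_pot hs (sub_ne_zero.2 hx)
  have ht : Tendsto (fun y => y - a) (𝓝 x) (𝓝 (x - a)) :=
    (continuous_id.sub continuous_const).tendsto x
  refine ⟨h1.comp x (contDiffAt_id.sub contDiffAt_const), ?_⟩
  filter_upwards [ht.eventually h2] with y hy
  rw [laplacian_comp_sub, hy]
  rfl

/-- After scaling back, the poles lie at distance at least `2 δ` from `K`, hence outside its
`δ`-neighbourhood. -/
theorem harmonicOnNhd_of_mem_poleSpan (hs : (d : ℝ) = 2 * s + 2)
    {K : Set (EuclideanSpace ℝ (Fin d))} {δ : ℝ} (hδ : 0 < δ) {G : EuclideanSpace ℝ (Fin d) → ℝ}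
    (hG : G ∈ poleSpan s {x | δ • x ∈ K}) :
    InnerProductSpace.HarmonicOnNhd (fun x => G (δ⁻¹ • x)) (Metric.thickening δ K) := by
  induction hG using Submodule.span_induction with
  | mem g hg =>
    obtain ⟨a, ha, rfl⟩ := hg
    have e : (fun x : EuclideanSpace ℝ (Fin d) => pot s 0 (δ⁻¹ • x - a)) =
        (δ⁻¹ ^ 2) ^ (-s) • fun x => pot s 0 (x - δ • a) := by
      ext x
      rw [Pi.smul_apply, smul_eq_mul, ← pot_zero_smul, smul_sub, inv_smul_smul₀ hδ.ne']
    rw [e]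
    refine fun x hx => (harmonicAt_pot_sub hs ?_).const_smul
    rintro rfl
    obtain ⟨k, hk, hxk⟩ := Metric.mem_thickening_iff.1 hx
    have h1 := ha (δ⁻¹ • k) (by simpa [smul_inv_smul₀ hδ.ne'] using hk)
    have h2 : dist (δ • a) k = δ * dist a (δ⁻¹ • k) := by
      conv_lhs => rw [← smul_inv_smul₀ hδ.ne' k]
      rw [dist_smul₀, Real.norm_eq_abs, abs_of_pos hδ]
    nlinarith
  | zero => exact InnerProductSpace.harmonicOnNhd_const 0
  | add g₁ g₂ _ _ h₁ h₂ => exact h₁.add h₂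
  | smul r g _ h => exact h.const_smul

end Poles

/-! ### Moduli of continuity and the seminorm. -/

section Modulus

variable {d : ℕ} {ω : ℝ → ℝ}

/-- For `t ≥ 1`, concavity on the segment from 0 to `δ * t`, with `ω 0 = 0`; for `t ≤ 1`,
monotonicity. -/
theorem IsModulus.le_max_mul (hω : IsModulus ω) {δ t : ℝ} (hδ : 0 < δ) (ht : 0 ≤ t) :
    ω (δ * t) ≤ max 1 t * ω δ := by
  have hδω := (hω.pos δ hδ).le
  rcases le_total t 1 with h | h
  · rw [max_eq_left h, one_mul]
    exact hω.monotoneOn (show 0 ≤ δ * t by positivity) hδ.le (mul_le_of_le_one_right hδ.le h)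
  · have ht0 : 0 < t := by linarith
    have h0 : (0 : ℝ) ∈ Ici 0 := self_mem_Ici
    have h1 : δ * t ∈ Ici (0 : ℝ) := mul_nonneg hδ.le ht
    have h2 : 0 ≤ 1 - t⁻¹ := by simpa using inv_le_one_of_one_le₀ h
    have h3 : 0 ≤ t⁻¹ := by positivity
    have := hω.concaveOn.2 h0 h1 h2 h3 (sub_add_cancel _ _)
    simp only [hω.map_zero, smul_eq_mul, mul_zero, zero_add] at this
    rw [show t⁻¹ * (δ * t) = δ by field_simp, inv_mul_le_iff₀ ht0] at this
    rwa [max_eq_right h]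

theorem lipSeminorm_ne_top (hω : IsModulus ω) {f : EuclideanSpace ℝ (Fin d) → ℝ}
    (hf : ContDiff ℝ (⊤ : ℕ∞) f) (hc : HasCompactSupport f) : lipSeminorm ω univ f ≠ ⊤ := by
  obtain ⟨L, hL⟩ := hf.lipschitzWith_of_hasCompactSupport hc (by simp)
  obtain ⟨B, hB⟩ := hc.exists_bound_of_continuous hf.continuous
  have hB0 : 0 ≤ B := (norm_nonneg _).trans (hB 0)
  have hω1 := hω.pos 1 one_pos
  refine ne_top_of_le_ne_top ENNReal.ofReal_ne_top (b := ENNReal.ofReal ((L + 2 * B) / ω 1)) ?_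
  refine iSup₂_le fun x _ => iSup₂_le fun y _ => iSup_le fun hxy => ENNReal.ofReal_le_ofReal ?_
  have ht : 0 < dist x y := dist_pos.2 hxy
  have h1 : |f x - f y| ≤ L * dist x y := hL.dist_le_mul x y
  have h2 : |f x - f y| ≤ 2 * B := by
    have := (abs_sub (f x) (f y)).trans (add_le_add (hB x) (hB y))
    linarith
  -- This gives `ω t ≥ min(1, t) ω 1`: the Lipschitz bound on `f` handles small distances and the
  -- sup bound large ones.
  have h3 := hω.le_max_mul ht (t := (dist x y)⁻¹) (by positivity)
  rw [mul_inv_cancel₀ ht.ne'] at h3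
  rw [div_le_div_iff₀ (hω.pos _ ht) hω1]
  have hωt := (hω.pos _ ht).le
  calc |f x - f y| * ω 1 ≤ |f x - f y| * (max 1 (dist x y)⁻¹ * ω (dist x y)) := by gcongr
    _ = (|f x - f y| * max 1 (dist x y)⁻¹) * ω (dist x y) := by ring
    _ ≤ (L + 2 * B) * ω (dist x y) := by
      gcongr
      rcases le_total 1 (dist x y)⁻¹ with h | h
      · rw [max_eq_right h]
        have : |f x - f y| * (dist x y)⁻¹ ≤ L := by rwa [mul_inv_le_iff₀ ht]
        linarith
      · rw [max_eq_left h]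
        linarith [L.coe_nonneg]

theorem abs_sub_le_lipSeminorm_mul (hω : IsModulus ω) {f : EuclideanSpace ℝ (Fin d) → ℝ}
    (hf : lipSeminorm ω univ f ≠ ⊤) (x y : EuclideanSpace ℝ (Fin d)) :
    |f x - f y| ≤ (lipSeminorm ω univ f).toReal * ω (dist x y) := by
  rcases eq_or_ne x y with rfl | hxy
  · simp [hω.map_zero]
  · rw [← div_le_iff₀ (hω.pos _ (dist_pos.2 hxy))]
    refine (ENNReal.ofReal_le_iff_le_toReal hf).1 ?_
    exact le_iSup₂_of_le x (mem_univ _) (le_iSup₂_of_le y (mem_univ _) (le_iSup_of_le hxy le_rfl))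

end Modulus

/-! ### Boundedness of cubes and the geometric use of porosity. -/

theorem isBounded_cube {d : ℕ} (a : EuclideanSpace ℝ (Fin d)) (l : ℝ) :
    Bornology.IsBounded (cube a l) := by
  refine (Metric.isBounded_closedBall (x := a) (r := √(∑ _i : Fin d, l ^ 2))).subset fun x hx => ?_
  rw [Metric.mem_closedBall, EuclideanSpace.dist_eq]
  refine Real.sqrt_le_sqrt (Finset.sum_le_sum fun i _ => ?_)
  have := hx i
  rw [Real.dist_eq, sq_abs]
  nlinarith

/-- At every scale and near every point, a porous set leaves out a ball of comparable size. -/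
theorem IsPorous.exists_far_point {d : ℕ} (hd : d ≠ 0) {K : Set (EuclideanSpace ℝ (Fin d))}
    (hK : IsPorous K) : ∃ M : ℝ, 2 ≤ M ∧ ∀ δ : ℝ, 0 < δ → ∀ x, ∃ z, dist x z ≤ M ∧
      ∀ k ∈ {y | δ • y ∈ K}, 4 ≤ dist z k := by
  obtain ⟨-, -, c, hc0, hc1, hc⟩ := hK
  have hM : 4 ≤ 4 / c := by rw [le_div_iff₀ hc0]; linarith
  refine ⟨4 / c, by linarith, fun δ hδ x => ?_⟩
  -- The radius is chosen so that `c * r = 4 * δ`.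
  set r := 4 / c * δ with hr
  have hr0 : 0 < r := by positivity
  obtain ⟨y, s, hs, hys, hyK, hv⟩ := hc (δ • x) r hr0
  have hne : Nonempty (Fin d) := ⟨⟨0, Nat.pos_of_ne_zero hd⟩⟩
  have hnt : Nontrivial (EuclideanSpace ℝ (Fin d)) := inferInstance
  have h4 : 4 * δ ≤ s := by
    have h1 : c * r ^ d ≤ s ^ d := by
      rw [Measure.addHaar_ball _ _ hr0.le, Measure.addHaar_ball _ _ hs.le, ← mul_assoc,
        ← ENNReal.ofReal_mul hc0.le, ENNReal.mul_le_mul_iff_left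
          (Metric.measure_ball_pos _ _ one_pos).ne' measure_ball_lt_top.ne,
        finrank_euclideanSpace_fin, ENNReal.ofReal_le_ofReal_iff (by positivity)] at hv
      exact hv
    -- Since `c < 1`, `c ^ d ≤ c`. This loses the sharp exponent `1 / d` but avoids roots.
    have h2 : (c * r) ^ d ≤ s ^ d := by
      refine le_trans ?_ h1
      rw [mul_pow]
      gcongr
      exact pow_le_of_le_one hc0.le hc1.le hd
    have h3 := le_of_pow_le_pow_left₀ hd hs.le h2
    rwa [hr, ← mul_assoc, mul_div_cancel₀ _ hc0.ne'] at h3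
  have hdist (u v : EuclideanSpace ℝ (Fin d)) : dist (δ • u) (δ • v) = δ * dist u v := by
    rw [dist_smul₀, Real.norm_eq_abs, abs_of_pos hδ]
  refine ⟨δ⁻¹ • y, ?_, fun k hk => ?_⟩
  · have h5 := hys (Metric.mem_ball_self hs)
    rw [Metric.mem_ball, dist_comm] at h5
    have h6 := hdist x (δ⁻¹ • y)
    rw [smul_inv_smul₀ hδ.ne'] at h6
    nlinarith
  · have h5 : δ • k ∉ Metric.ball y s := fun h => by
      have : δ • k ∈ Metric.ball y s ∩ K := ⟨h, hk⟩
      simp [hyK] at this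
    rw [Metric.mem_ball, not_lt, dist_comm] at h5
    have h6 := hdist (δ⁻¹ • y) k
    rw [smul_inv_smul₀ hδ.ne'] at h6
    nlinarith

end HarmonicApprox

/-! ### The main theorem, by rescaling to `δ = 1`. -/

theorem proposition1 (d : ℕ) (hd : 2 < d) (K : Set (EuclideanSpace ℝ (Fin d)))
    (hK : HarmonicApprox.IsPorous K) :
    ∃ C : ℝ, 0 < C ∧
      ∀ (a : EuclideanSpace ℝ (Fin d)) (l : ℝ), 0 < l →
        K ⊆ HarmonicApprox.cube a l →
        1 / 4 ≤ HarmonicApprox.setDist K (frontier (HarmonicApprox.cube a l)) →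
        ∀ ω : ℝ → ℝ, HarmonicApprox.IsModulus ω →
        ∀ f : EuclideanSpace ℝ (Fin d) → ℝ, ContDiff ℝ (⊤ : ℕ∞) f →
          tsupport f ⊆ HarmonicApprox.cube a l →
          HarmonicApprox.lipSeminorm ω univ f ≠ ⊤ ∧
          ∀ δ : ℝ, 0 < δ → δ < 1 / 4 →
            ∃ G : EuclideanSpace ℝ (Fin d) → ℝ,
              InnerProductSpace.HarmonicOnNhd G (Metric.thickening δ K) ∧
              (⨆ x ∈ Metric.thickening δ K, ENNReal.ofReal |f x - G x|) ≤
                ENNReal.ofReal C * HarmonicApprox.lipSeminorm ω univ f *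
                  ENNReal.ofReal (ω δ) := by
  have hd2 : (2 : ℝ) < d := by exact_mod_cast hd
  obtain ⟨M, hM, hfar⟩ := hK.exists_far_point (by omega)
  obtain ⟨C, hC, happ⟩ := HarmonicApprox.exists_poleSpan_approximation (d := d) (s := (d - 2) / 2)
    (by ring) (by linarith) hM
  -- The added 1 makes the constant strictly positive.
  refine ⟨C + 1, by linarith, fun a l _ _ _ ω hω f hf hfa => ?_⟩
  have hcf : HasCompactSupport f := Metric.isCompact_of_isClosed_isBounded (isClosed_tsupport f)
    ((HarmonicApprox.isBounded_cube a l).subset hfa)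
  have htop := HarmonicApprox.lipSeminorm_ne_top hω hf hcf
  refine ⟨htop, fun δ hδ _ => ?_⟩
  have hωδ := hω.pos δ hδ
  have hdist (u v : EuclideanSpace ℝ (Fin d)) : dist (δ • u) (δ • v) = δ * dist u v := by
    rw [dist_smul₀, Real.norm_eq_abs, abs_of_pos hδ]
  -- The scale-one result is applied to `f (δ • ·)` and the dilated set. `M` serves every `δ`, so
  -- `C` is independent of `δ`.
  obtain ⟨G, hG, hfG⟩ := happ {x | δ • x ∈ K} (hfar δ hδ) (fun x => f (δ • x))
    (hf.continuous.comp (continuous_const_smul δ)) (hcf.comp_smul hδ.ne')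
    ((HarmonicApprox.lipSeminorm ω univ f).toReal * ω δ) (by positivity) fun x y => by
      refine (HarmonicApprox.abs_sub_le_lipSeminorm_mul hω htop _ _).trans ?_
      rw [hdist, mul_assoc, mul_comm (ω δ)]
      gcongr
      exact hω.le_max_mul hδ dist_nonneg
  refine ⟨fun x => G (δ⁻¹ • x), HarmonicApprox.harmonicOnNhd_of_mem_poleSpan (by ring) hδ hG, ?_⟩
  refine iSup₂_le fun x hx => ?_
  obtain ⟨k, hk, hxk⟩ := Metric.mem_thickening_iff.1 hx
  have hx' : δ⁻¹ • x ∈ Metric.thickening 1 {x | δ • x ∈ K} := by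
    refine Metric.mem_thickening_iff.2 ⟨δ⁻¹ • k, by simpa [smul_inv_smul₀ hδ.ne'] using hk, ?_⟩
    have := hdist (δ⁻¹ • x) (δ⁻¹ • k)
    rw [smul_inv_smul₀ hδ.ne', smul_inv_smul₀ hδ.ne'] at this
    nlinarith
  have h := hfG _ hx'
  rw [smul_inv_smul₀ hδ.ne'] at h
  calc ENNReal.ofReal |f x - G (δ⁻¹ • x)|
      ≤ ENNReal.ofReal ((C + 1) * (HarmonicApprox.lipSeminorm ω univ f).toReal * ω δ) := by
        refine ENNReal.ofReal_le_ofReal (h.trans ?_)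
        rw [← mul_assoc]
        gcongr
        linarith
    _ = _ := by
      rw [ENNReal.ofReal_mul (by positivity), ENNReal.ofReal_mul (by positivity),
        ENNReal.ofReal_toReal htop]
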